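/- For $n\in\mathbb N$ and a real number $0<s\le n$ let $$S_{n,s}=\{x\in\mathbb R^n:\ \|x\|_0\le s,\ \|x\|_2\le 1\},$$ where $\|x\|_0$ is the number of nonzero entries of $x$ and $\|x\|_2$ is the Euclidean norm. For $K\subseteq\mathbb R^n$ let $$w(K)=\mathbb E\sup_{x\in K-K}\langle g,x\rangle,\qquad K-K=\{x-y:\ x,y\in K\},$$ be the Gaussian mean width, where $g$ is a standard normal random vector in $\mathbb R^n$. There exist absolute constants $c,C>0$ such that for all $n\in\mathbb N$ and all real $s$ with $0<s\le n$ the expectation defining $w(S_{n,s})$ is finite and $$w(S_{n,s})^2\le C\,s\log(2n/s),$$ and, if moreover $s\ge 1$, $$c\,s\log(2n/s)\le w(S_{n,s})^2 .$$ -/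

import Mathlib

open MeasureTheory ProbabilityTheory
open scoped Pointwise

/-- The width functional of a set `K ⊆ ℝⁿ` in direction `g`: the supremum of `⟨g, x⟩` over the
Minkowski difference `K - K`. (The supremum is a real supremum; it is the genuine one whenever `K`
is nonempty and bounded, see `bddAbove_inner_image_sub`.) -/
noncomputable def widthAlong {n : ℕ} (K : Set (EuclideanSpace ℝ (Fin n)))
    (g : EuclideanSpace ℝ (Fin n)) : ℝ :=
  sSup ((fun x => inner ℝ g x) '' (K - K))

/-- The Gaussian mean width `w(K) = 𝔼 sup_{x ∈ K - K} ⟨g, x⟩`, with `g` a standard normal random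
vector in `ℝⁿ`. -/
noncomputable def gaussianMeanWidth {n : ℕ} (K : Set (EuclideanSpace ℝ (Fin n))) : ℝ :=
  ∫ g, widthAlong K g ∂(stdGaussian (EuclideanSpace ℝ (Fin n)))

/-- The set `S_{n,s}` of vectors in `ℝⁿ` with at most `s` nonzero entries (`s` real) and with
Euclidean norm at most `1`. -/
def sparseSignalSet (n : ℕ) (s : ℝ) : Set (EuclideanSpace ℝ (Fin n)) :=
  {x | (hammingNorm (WithLp.ofLp x) : ℝ) ≤ s ∧ ‖x‖ ≤ 1}

theorem bddAbove_inner_image_sub {n : ℕ} {K : Set (EuclideanSpace ℝ (Fin n))}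
    (hK : Bornology.IsBounded K) (g : EuclideanSpace ℝ (Fin n)) :
    BddAbove ((fun x => inner ℝ g x) '' (K - K)) := by
  obtain ⟨R, hR⟩ := (hK.sub hK).exists_norm_le
  refine ⟨‖g‖ * R, ?_⟩
  rintro _ ⟨x, hx, rfl⟩
  exact (real_inner_le_norm g x).trans (mul_le_mul_of_nonneg_left (hR x hx) (norm_nonneg g))

theorem sparseSignalSet_isBounded (n : ℕ) (s : ℝ) :
    Bornology.IsBounded (sparseSignalSet n s) :=
  isBounded_iff_forall_norm_le.2 ⟨1, fun _ hx => hx.2⟩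

/-! Upper bound: Cauchy–Schwarz on the support bounds `⟨g, x⟩²` by a sum of at most `s` squares `g i
^ 2`. Each square is at most `t + 4 exp ((g i ^ 2 - t) / 4)`, and extending the exponential sum to
all coordinates makes the bound uniform in the support, so no union bound is needed
(`inner_sq_le_of_mem_sparse`). Taking expectations with `t = 4 log (2n/s)` leaves `O(s log (2n/s)) +
O(s)`.

Lower bound: with `m = ⌊s⌋` and `k = ⌊n/m⌋`, choose `m` disjoint blocks of `k` coordinates. Each
block has an entry of size at least `√(log (2k))` with probability bounded below; a normalised sign
vector on one large coordinate per block gives width of order `√(m log (2k))`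
(`le_gaussianMeanWidth_sparse`). -/

/-! ### Gaussian moments, tails and independent coordinates. -/

theorem integrable_exp_sq_div_four_gaussianReal :
    Integrable (fun x : ℝ => Real.exp (x ^ 2 / 4)) (gaussianReal 0 1) ∧
      ∫ x, Real.exp (x ^ 2 / 4) ∂(gaussianReal 0 1) = √2 := by
  have key : ∀ x : ℝ, gaussianPDFReal 0 1 x * Real.exp (x ^ 2 / 4) =
      (√(2 * Real.pi))⁻¹ * Real.exp (-(1 / 4) * x ^ 2) := by
    intro x
    rw [gaussianPDFReal, mul_assoc, ← Real.exp_add]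
    simp only [NNReal.coe_one, mul_one, sub_zero]
    congr 2
    ring
  constructor
  · rw [gaussianReal_of_var_ne_zero _ one_ne_zero,
      integrable_withDensity_iff_integrable_smul' (measurable_gaussianPDF _ _)
        (ae_of_all _ fun _ => gaussianPDF_lt_top)]
    simp only [toReal_gaussianPDF, smul_eq_mul, key]
    exact (integrable_exp_neg_mul_sq (by norm_num)).const_mul _
  · rw [integral_gaussianReal_eq_integral_smul one_ne_zero]
    simp only [smul_eq_mul, key]
    rw [integral_const_mul, integral_gaussian, ← Real.sqrt_inv, ← Real.sqrt_mul (by positivity)]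
    congr 1
    field_simp
    norm_num

theorem measurePreserving_eval_stdGaussian {n : ℕ} (i : Fin n) :
    MeasurePreserving (fun g : EuclideanSpace ℝ (Fin n) => g i)
      (stdGaussian (EuclideanSpace ℝ (Fin n))) (gaussianReal 0 1) := by
  refine ⟨by fun_prop, ?_⟩
  rw [← map_pi_eq_stdGaussian, Measure.map_map (by fun_prop) (by fun_prop)]
  exact (measurePreserving_eval (fun _ : Fin n => gaussianReal 0 1) i).map_eq

theorem stdGaussian_forall_mem {n : ℕ} (T : Finset (Fin n)) {A : Set ℝ} (hA : MeasurableSet A) :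
    stdGaussian (EuclideanSpace ℝ (Fin n)) {g | ∀ i ∈ T, g i ∈ A} =
      gaussianReal 0 1 A ^ T.card := by
  have hm : MeasurableSet {g : EuclideanSpace ℝ (Fin n) | ∀ i ∈ T, g i ∈ A} := by
    have : {g : EuclideanSpace ℝ (Fin n) | ∀ i ∈ T, g i ∈ A} =
        ⋂ i ∈ T, (fun g : EuclideanSpace ℝ (Fin n) => g i) ⁻¹' A := by
      ext; simp
    rw [this]
    exact T.measurableSet_biInter fun i _ => (by fun_prop : Measurable fun
      g : EuclideanSpace ℝ (Fin n) => g i) hA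
  rw [← map_pi_eq_stdGaussian, Measure.map_apply (by fun_prop) hm]
  have : WithLp.toLp 2 ⁻¹' {g : EuclideanSpace ℝ (Fin n) | ∀ i ∈ T, g i ∈ A} =
      Set.univ.pi (fun i => if i ∈ T then A else Set.univ) := by
    ext g
    simp only [Set.mem_preimage, Set.mem_ofPred_eq, Set.mem_pi, Set.mem_univ, true_imp_iff]
    refine forall_congr' fun i => ?_
    by_cases hi : i ∈ T <;> simp [hi]
  rw [this, Measure.pi_pi]
  simp [apply_ite (gaussianReal 0 1)]

/-- The exponent is cruder than the sharp `τ ^ 2 / 2`, which costs only constants: at `τ = √(log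
(2k))` the bound is a constant over `2k`. -/
theorem le_gaussianReal_tail (τ : ℝ) :
    (√(2 * Real.pi))⁻¹ * Real.exp (-1) * Real.exp (-τ ^ 2) ≤
      (gaussianReal 0 1).real {x | τ ≤ |x|} := by
  have hsub : Set.Icc τ (τ + 1) ⊆ {x | τ ≤ |x|} := fun x hx => hx.1.trans (le_abs_self x)
  refine le_trans ?_ (measureReal_mono hsub)
  rw [measureReal_def, gaussianReal_apply_eq_integral _ one_ne_zero,
    ENNReal.toReal_ofReal (integral_nonneg fun _ => gaussianPDFReal_nonneg _ _ _)]
  have h : ∀ x ∈ Set.Icc τ (τ + 1), (√(2 * Real.pi))⁻¹ * Real.exp (-1) * Real.exp (-τ ^ 2) ≤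
      gaussianPDFReal 0 1 x := by
    intro x hx
    rw [gaussianPDFReal, mul_assoc, ← Real.exp_add]
    simp only [NNReal.coe_one, mul_one, sub_zero]
    gcongr
    -- On this interval `x² ≤ 2τ² + 2(x - τ)² ≤ 2τ² + 2`.
    nlinarith [hx.1, hx.2, sq_nonneg (τ - 1)]
  calc _ = ∫ x in Set.Icc τ (τ + 1),
        (√(2 * Real.pi))⁻¹ * Real.exp (-1) * Real.exp (-τ ^ 2) := by simp
    _ ≤ _ := setIntegral_mono_on continuous_const.integrableOn_Icc
        (integrable_gaussianPDFReal _ _).integrableOn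
        measurableSet_Icc h

/-- A block of `k` standard Gaussian coordinates has an entry of size at least `√(log (2k))` with
probability bounded below by an absolute constant. -/
theorem le_stdGaussian_exists_sqrt_log_le {n : ℕ} (T : Finset (Fin n)) (hT : 0 < T.card) :
    1 - Real.exp (-((√(2 * Real.pi))⁻¹ * Real.exp (-1) / 2)) ≤
      (stdGaussian (EuclideanSpace ℝ (Fin n))).real
        {g | ∃ i ∈ T, √(Real.log (2 * T.card)) ≤ |g i|} := by
  set τ := √(Real.log (2 * T.card))
  have hk : (1 : ℝ) ≤ T.card := by exact_mod_cast hT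
  set p := (gaussianReal 0 1).real {x | τ ≤ |x|} with hp
  have hms : MeasurableSet {x : ℝ | τ ≤ |x|} := measurableSet_le (by fun_prop) (by fun_prop)
  have htail : (√(2 * Real.pi))⁻¹ * Real.exp (-1) / 2 ≤ T.card * p := by
    have h := le_gaussianReal_tail √(Real.log (2 * T.card))
    rw [Real.sq_sqrt (Real.log_nonneg (by linarith)), Real.exp_neg (Real.log _),
      Real.exp_log (by linarith)] at h
    calc _ = T.card * ((√(2 * Real.pi))⁻¹ * Real.exp (-1) * (2 * (T.card : ℝ))⁻¹) := by
          field_simp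
      _ ≤ _ := mul_le_mul_of_nonneg_left h (by linarith)
  have hmE : MeasurableSet {g : EuclideanSpace ℝ (Fin n) | ∃ i ∈ T, τ ≤ |g i|} := by
    have : {g : EuclideanSpace ℝ (Fin n) | ∃ i ∈ T, τ ≤ |g i|} =
        ⋃ i ∈ T, (fun g : EuclideanSpace ℝ (Fin n) => g i) ⁻¹' {x : ℝ | τ ≤ |x|} := by
      ext; simp
    rw [this]
    exact T.measurableSet_biUnion fun i _ => (by fun_prop : Measurable fun
      g : EuclideanSpace ℝ (Fin n) => g i) hms
  have hc : {g : EuclideanSpace ℝ (Fin n) | ∃ i ∈ T, τ ≤ |g i|}ᶜ =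
      {g | ∀ i ∈ T, g i ∈ {x : ℝ | τ ≤ |x|}ᶜ} := by
    ext; simp
  have hpr := probReal_compl_eq_one_sub (μ := stdGaussian (EuclideanSpace ℝ (Fin n))) hmE
  rw [hc, measureReal_def, stdGaussian_forall_mem T hms.compl, ENNReal.toReal_pow,
    ← measureReal_def, probReal_compl_eq_one_sub hms, ← hp] at hpr
  have hle : (1 - p) ^ T.card ≤ Real.exp (-((√(2 * Real.pi))⁻¹ * Real.exp (-1) / 2)) := by
    calc (1 - p) ^ T.card ≤ Real.exp (-p) ^ T.card :=
          pow_le_pow_left₀ (sub_nonneg.2 measureReal_le_one) (Real.one_sub_le_exp_neg p) _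
      _ = Real.exp (-(T.card * p)) := by rw [← Real.exp_nat_mul]; ring_nf
      _ ≤ _ := Real.exp_le_exp.2 (neg_le_neg htail)
  linarith

/-! ### Regularity and integrability of the width. -/

theorem zero_mem_sparseSignalSet (n : ℕ) {s : ℝ} (hs : 0 ≤ s) : 0 ∈ sparseSignalSet n s := by
  simp [sparseSignalSet, hs]

theorem neg_mem_sparseSignalSet {n : ℕ} {s : ℝ} {x : EuclideanSpace ℝ (Fin n)}
    (hx : x ∈ sparseSignalSet n s) : -x ∈ sparseSignalSet n s := by
  refine ⟨?_, by simpa using hx.2⟩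
  have : hammingNorm (WithLp.ofLp (-x)) = hammingNorm (WithLp.ofLp x) := by
    simp [hammingNorm]
  rw [this]
  exact hx.1

theorem widthAlong_le {n : ℕ} {K : Set (EuclideanSpace ℝ (Fin n))} (hK : K.Nonempty)
    {g : EuclideanSpace ℝ (Fin n)} {b : ℝ}
    (h : ∀ x ∈ K, ∀ y ∈ K, inner ℝ g (x - y) ≤ b) : widthAlong K g ≤ b := by
  refine csSup_le ((hK.sub hK).image _) ?_
  rintro _ ⟨_, ⟨x, hx, y, hy, rfl⟩, rfl⟩
  exact h x hx y hy

theorem inner_sub_le_widthAlong {n : ℕ} {K : Set (EuclideanSpace ℝ (Fin n))}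
    (hK : Bornology.IsBounded K) (g : EuclideanSpace ℝ (Fin n)) {x y : EuclideanSpace ℝ (Fin n)}
    (hx : x ∈ K) (hy : y ∈ K) : inner ℝ g (x - y) ≤ widthAlong K g :=
  le_csSup (bddAbove_inner_image_sub hK g) ⟨_, Set.sub_mem_sub hx hy, rfl⟩

theorem widthAlong_nonneg {n : ℕ} {K : Set (EuclideanSpace ℝ (Fin n))}
    (hK : Bornology.IsBounded K) (hne : K.Nonempty) (g : EuclideanSpace ℝ (Fin n)) :
    0 ≤ widthAlong K g := by
  obtain ⟨x, hx⟩ := hne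
  simpa using inner_sub_le_widthAlong hK g hx hx

theorem widthAlong_sparse_le_norm {n : ℕ} {s : ℝ} (hs : 0 ≤ s) (g : EuclideanSpace ℝ (Fin n)) :
    widthAlong (sparseSignalSet n s) g ≤ 2 * ‖g‖ := by
  refine widthAlong_le ⟨0, zero_mem_sparseSignalSet n hs⟩ fun x hx y hy => ?_
  have h1 := real_inner_le_norm g (x - y)
  have h2 := norm_sub_le x y
  nlinarith [hx.2, hy.2, norm_nonneg g]

/-- Continuity settles the measurability of this uncountable supremum. -/
theorem lipschitzWith_widthAlong_sparse (n : ℕ) {s : ℝ} (hs : 0 ≤ s) :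
    LipschitzWith 2 (widthAlong (sparseSignalSet n s)) := by
  refine LipschitzWith.of_le_add_mul 2 fun g h => ?_
  refine widthAlong_le ⟨0, zero_mem_sparseSignalSet n hs⟩ fun x hx y hy => ?_
  have h0 : (inner ℝ g (x - y) : ℝ) = inner ℝ h (x - y) + inner ℝ (g - h) (x - y) := by
    rw [← inner_add_left]; simp
  have h1 := real_inner_le_norm (g - h) (x - y)
  have h2 := norm_sub_le x y
  have h3 := inner_sub_le_widthAlong (sparseSignalSet_isBounded n s) h hx hy
  rw [dist_eq_norm, h0, NNReal.coe_ofNat]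
  nlinarith [hx.2, hy.2, norm_nonneg (g - h)]

theorem memLp_two_widthAlong_sparse (n : ℕ) {s : ℝ} (hs : 0 ≤ s) :
    MemLp (widthAlong (sparseSignalSet n s)) 2 (stdGaussian (EuclideanSpace ℝ (Fin n))) := by
  refine MemLp.of_le_mul (c := 2)
    (IsGaussian.memLp_two_id (μ := stdGaussian (EuclideanSpace ℝ (Fin n))))
    (lipschitzWith_widthAlong_sparse n hs).continuous.aestronglyMeasurable
    (ae_of_all _ fun g => ?_)
  rw [Real.norm_of_nonneg (widthAlong_nonneg (sparseSignalSet_isBounded n s)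
    ⟨0, zero_mem_sparseSignalSet n hs⟩ g)]
  exact widthAlong_sparse_le_norm hs g

/-! ### Upper bound. -/

theorem inner_sq_le_sum_support {n : ℕ} (g x : EuclideanSpace ℝ (Fin n)) (hx : ‖x‖ ≤ 1) :
    (inner ℝ g x : ℝ) ^ 2 ≤ ∑ i with x i ≠ 0, g i ^ 2 := by
  have h1 : (inner ℝ g x : ℝ) = ∑ i with x i ≠ 0, g i * x i := by
    rw [PiLp.inner_apply, Finset.sum_filter]
    refine Finset.sum_congr rfl fun i _ => ?_
    by_cases h : x i = 0 <;> simp [h, mul_comm]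
  have h2 : ∑ i with x i ≠ 0, x i ^ 2 ≤ 1 := by
    calc _ ≤ ∑ i, x i ^ 2 :=
          Finset.sum_le_sum_of_subset_of_nonneg (Finset.filter_subset _ _)
            fun _ _ _ => sq_nonneg _
      _ = ‖x‖ ^ 2 := (EuclideanSpace.real_norm_sq_eq x).symm
      _ ≤ 1 := pow_le_one₀ (norm_nonneg x) hx
  rw [h1]
  refine (Finset.sum_mul_sq_le_sq_mul_sq _ _ _).trans ?_
  exact mul_le_of_le_one_right (Finset.sum_nonneg fun _ _ => sq_nonneg _) h2

theorem inner_sq_le_of_mem_sparse {n : ℕ} {s t : ℝ} (ht : 0 ≤ t)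
    (g : EuclideanSpace ℝ (Fin n)) {x : EuclideanSpace ℝ (Fin n)}
    (hx : x ∈ sparseSignalSet n s) :
    (inner ℝ g x : ℝ) ^ 2 ≤ s * t + 4 * Real.exp (-t / 4) * ∑ i, Real.exp (g i ^ 2 / 4) := by
  calc (inner ℝ g x : ℝ) ^ 2 ≤ ∑ i with x i ≠ 0, g i ^ 2 := inner_sq_le_sum_support g x hx.2
    _ ≤ ∑ i with x i ≠ 0, (t + 4 * Real.exp (-t / 4) * Real.exp (g i ^ 2 / 4)) := by
        refine Finset.sum_le_sum fun i _ => ?_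
        rw [mul_assoc, ← Real.exp_add]
        -- This is `u ≤ exp u` at `u = (g i ^ 2 - t) / 4`, multiplied by 4.
        linarith [Real.add_one_le_exp (-t / 4 + g i ^ 2 / 4)]
    _ = (hammingNorm (WithLp.ofLp x) : ℝ) * t +
          4 * Real.exp (-t / 4) * ∑ i with x i ≠ 0, Real.exp (g i ^ 2 / 4) := by
        rw [Finset.sum_add_distrib, Finset.sum_const, nsmul_eq_mul, ← Finset.mul_sum]
        rfl
    _ ≤ _ := by
        refine add_le_add (mul_le_mul_of_nonneg_right hx.1 ht)
          (mul_le_mul_of_nonneg_left ?_ (by positivity))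
        exact Finset.sum_le_sum_of_subset_of_nonneg (Finset.filter_subset _ _)
          fun _ _ _ => (Real.exp_pos _).le

theorem widthAlong_sparse_sq_le {n : ℕ} {s t : ℝ} (hs : 0 ≤ s) (ht : 0 ≤ t)
    (g : EuclideanSpace ℝ (Fin n)) :
    widthAlong (sparseSignalSet n s) g ^ 2 ≤
      4 * (s * t + 4 * Real.exp (-t / 4) * ∑ i, Real.exp (g i ^ 2 / 4)) := by
  set B := s * t + 4 * Real.exp (-t / 4) * ∑ i, Real.exp (g i ^ 2 / 4)
  have hB : 0 ≤ B := by positivity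
  have h : widthAlong (sparseSignalSet n s) g ≤ 2 * √B := by
    refine widthAlong_le ⟨0, zero_mem_sparseSignalSet n hs⟩ fun x hx y hy => ?_
    have h1 := Real.le_sqrt_of_sq_le (inner_sq_le_of_mem_sparse ht g hx)
    have h2 := Real.le_sqrt_of_sq_le (inner_sq_le_of_mem_sparse ht g (neg_mem_sparseSignalSet hy))
    rw [sub_eq_add_neg, inner_add_right]
    linarith
  calc _ ≤ (2 * √B) ^ 2 := pow_le_pow_left₀ (widthAlong_nonneg (sparseSignalSet_isBounded n s)
        ⟨0, zero_mem_sparseSignalSet n hs⟩ g) h 2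
    _ = 4 * B := by rw [mul_pow, Real.sq_sqrt hB]; norm_num

theorem gaussianMeanWidth_sparse_sq_le {n : ℕ} {s t : ℝ} (hs : 0 ≤ s) (ht : 0 ≤ t) :
    gaussianMeanWidth (sparseSignalSet n s) ^ 2 ≤
      4 * (s * t + 4 * Real.exp (-t / 4) * (n * √2)) := by
  have hmem := memLp_two_widthAlong_sparse n hs
  -- Nonnegative variance is the Jensen inequality `(𝔼 W)² ≤ 𝔼 W²`.
  have hvar := variance_nonneg (widthAlong (sparseSignalSet n s))
    (stdGaussian (EuclideanSpace ℝ (Fin n)))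
  rw [variance_eq_sub hmem] at hvar
  have hint : ∀ i : Fin n, Integrable (fun g : EuclideanSpace ℝ (Fin n) => Real.exp (g i ^ 2 / 4))
      (stdGaussian (EuclideanSpace ℝ (Fin n))) := fun i =>
    (measurePreserving_eval_stdGaussian i).integrable_comp_of_integrable
      integrable_exp_sq_div_four_gaussianReal.1
  have hval : ∀ i : Fin n, ∫ g : EuclideanSpace ℝ (Fin n), Real.exp (g i ^ 2 / 4)
      ∂(stdGaussian (EuclideanSpace ℝ (Fin n))) = √2 := fun i => by
    rw [← integrable_exp_sq_div_four_gaussianReal.2,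
      ← (measurePreserving_eval_stdGaussian i).map_eq, integral_map (by fun_prop) (by fun_prop)]
  have hsum := integrable_finsetSum Finset.univ fun i _ => hint i
  calc gaussianMeanWidth (sparseSignalSet n s) ^ 2
      ≤ ∫ g, widthAlong (sparseSignalSet n s) g ^ 2
          ∂(stdGaussian (EuclideanSpace ℝ (Fin n))) := by
        simpa [gaussianMeanWidth] using hvar
    _ ≤ ∫ g : EuclideanSpace ℝ (Fin n),
          4 * (s * t + 4 * Real.exp (-t / 4) * ∑ i, Real.exp (g i ^ 2 / 4))
          ∂(stdGaussian (EuclideanSpace ℝ (Fin n))) :=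
        integral_mono hmem.integrable_sq
          (((integrable_const _).add (hsum.const_mul _)).const_mul _)
          fun g => widthAlong_sparse_sq_le hs ht g
    _ = _ := by
        rw [integral_const_mul, integral_add (integrable_const _) (hsum.const_mul _),
          integral_const_mul (4 * Real.exp (-t / 4)), integral_finsetSum _ fun i _ => hint i]
        simp [hval]

/-! ### Lower bound. -/

/-- The width along `g` is bounded below by testing against the normalised sign vector of `g` on
a set of coordinates. -/
theorem le_widthAlong_sparse {n m : ℕ} {s : ℝ} (hm : 0 < m) (hms : (m : ℝ) ≤ s)
    (T : Finset (Fin n)) (hT : T.card ≤ m) (g : EuclideanSpace ℝ (Fin n)) :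
    2 / √m * ∑ i ∈ T, |g i| ≤ widthAlong (sparseSignalSet n s) g := by
  have hm0 : (0 : ℝ) < m := by exact_mod_cast hm
  set x : EuclideanSpace ℝ (Fin n) :=
    WithLp.toLp 2 fun i => if i ∈ T then SignType.sign (g i) / √m else 0 with hxdef
  have hx : x ∈ sparseSignalSet n s := by
    constructor
    · refine le_trans (Nat.cast_le.2 (le_trans (Finset.card_le_card ?_) hT)) hms
      intro i hi
      by_contra h
      simp [hxdef, h] at hi
    · have h : ‖x‖ ^ 2 ≤ 1 ^ 2 := by
        rw [EuclideanSpace.real_norm_sq_eq]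
        calc ∑ i, x i ^ 2 ≤ ∑ i, if i ∈ T then 1 / (m : ℝ) else 0 := by
              refine Finset.sum_le_sum fun i _ => ?_
              by_cases hi : i ∈ T
              · simp only [hxdef, hi, if_true, div_pow, Real.sq_sqrt hm0.le]
                gcongr
                -- Only an inequality, since the sign of `0` is `0`.
                rcases lt_trichotomy (g i) 0 with h | h | h <;> simp [h]
              · simp [hxdef, hi]
          _ = T.card / (m : ℝ) := by simp [div_eq_mul_inv]
          _ ≤ 1 ^ 2 := by
              rw [one_pow, div_le_one hm0]
              exact_mod_cast hT
      exact le_of_sq_le_sq h one_pos.le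
  -- The difference `x - (-x)` supplies the factor 2.
  refine le_trans (le_of_eq ?_) (inner_sub_le_widthAlong (sparseSignalSet_isBounded n s) g hx
    (neg_mem_sparseSignalSet hx))
  rw [sub_neg_eq_add, inner_add_right, ← two_mul, PiLp.inner_apply, div_mul_eq_mul_div,
    mul_div_assoc, Finset.sum_div]
  congr 1
  rw [← Finset.sum_subset (Finset.subset_univ T) fun i _ hi => by simp [hxdef, hi]]
  refine Finset.sum_congr rfl fun i hi => ?_
  simp only [hxdef, hi, if_true, RCLike.inner_apply, conj_trivial]
  rw [div_mul_eq_mul_div, sign_mul_self]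

theorem le_gaussianMeanWidth_sparse {n m k : ℕ} {s : ℝ} (hm : 0 < m) (hk : 0 < k)
    (hms : (m : ℝ) ≤ s) (hmk : m * k ≤ n) :
    2 * (1 - Real.exp (-((√(2 * Real.pi))⁻¹ * Real.exp (-1) / 2))) * √m *
      √(Real.log (2 * k)) ≤ gaussianMeanWidth (sparseSignalSet n s) := by
  classical
  have hs : 0 ≤ s := (Nat.cast_nonneg m).trans hms
  have hm0 : (0 : ℝ) < m := by exact_mod_cast hm
  set q := 1 - Real.exp (-((√(2 * Real.pi))⁻¹ * Real.exp (-1) / 2))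
  set τ := √(Real.log (2 * k))
  obtain ⟨e⟩ : Nonempty (Fin m × Fin k ↪ Fin n) :=
    Function.Embedding.nonempty_of_card_le (by simpa using hmk)
  set blk : Fin m → Finset (Fin n) := fun j => Finset.univ.image fun i => e (j, i) with hblk
  have hcard : ∀ j, (blk j).card = k := fun j => by
    rw [hblk, Finset.card_image_of_injective _ fun a b h => (Prod.mk.inj (e.injective h)).2]
    simp
  set E : Fin m → Set (EuclideanSpace ℝ (Fin n)) := fun j => {g | ∃ i ∈ blk j, τ ≤ |g i|} with hE
  have hprob : ∀ j, q ≤ (stdGaussian (EuclideanSpace ℝ (Fin n))).real (E j) := fun j => by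
    have h := le_stdGaussian_exists_sqrt_log_le (blk j) (by rw [hcard]; exact hk)
    rwa [hcard] at h
  have hmeas : ∀ j, MeasurableSet (E j) := fun j => by
    have : E j = ⋃ i ∈ blk j, {g : EuclideanSpace ℝ (Fin n) | τ ≤ |g i|} := by
      ext; simp [hE]
    rw [this]
    exact Finset.measurableSet_biUnion _ fun i _ => measurableSet_le (by fun_prop) (by fun_prop)
  have hpt : ∀ g, 2 / √m * ∑ j, (E j).indicator (fun _ => τ) g ≤
      widthAlong (sparseSignalSet n s) g := by
    intro g
    -- A block without a large entry contributes indicator `0`, so any of its coordinates will do.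
    have hch : ∀ j, ∃ i ∈ blk j, (E j).indicator (fun _ => τ) g ≤ |g i| := by
      intro j
      by_cases hj : g ∈ E j
      · obtain ⟨i, hi, h⟩ := hj
        exact ⟨i, hi, (Set.indicator_le_self' (fun _ _ => Real.sqrt_nonneg _) g).trans h⟩
      · obtain ⟨i, hi⟩ := Finset.card_pos.1 (by rw [hcard j]; exact hk)
        exact ⟨i, hi, by rw [Set.indicator_of_notMem hj]; positivity⟩
    choose f hf hfτ using hch
    -- The blocks are disjoint, so the chosen coordinates are distinct.
    have hinj : Function.Injective f := by
      intro a b hab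
      have ha := hf a
      have hb := hf b
      simp only [hblk, Finset.mem_image, Finset.mem_univ, true_and] at ha hb
      obtain ⟨i, hi⟩ := ha
      obtain ⟨i', hi'⟩ := hb
      exact (Prod.mk.inj (e.injective (hi.trans (hab.trans hi'.symm)))).1
    refine le_trans ?_ (le_widthAlong_sparse hm hms (Finset.univ.image f)
      (Finset.card_image_le.trans (by simp)) g)
    rw [Finset.sum_image fun a _ b _ h => hinj h]
    gcongr with j
    exact hfτ j
  have hind : ∀ j, Integrable ((E j).indicator fun _ => τ)
      (stdGaussian (EuclideanSpace ℝ (Fin n))) := fun j =>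
    (integrable_const τ).indicator (hmeas j)
  calc 2 * q * √m * τ = 2 / √m * ∑ _j : Fin m, q * τ := by
        rw [Finset.sum_const, Finset.card_univ, Fintype.card_fin, nsmul_eq_mul]
        rw [div_mul_eq_mul_div, eq_div_iff (Real.sqrt_pos.2 hm0).ne']
        linear_combination (2 * q * τ) * Real.mul_self_sqrt hm0.le
    _ ≤ 2 / √m * ∑ j, (stdGaussian (EuclideanSpace ℝ (Fin n))).real (E j) * τ := by
        gcongr with j
        exact hprob j
    _ = ∫ g, 2 / √m * ∑ j, (E j).indicator (fun _ => τ) g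
          ∂(stdGaussian (EuclideanSpace ℝ (Fin n))) := by
        rw [integral_const_mul, integral_finsetSum _ fun j _ => hind j]
        simp [integral_indicator_const, hmeas]
    _ ≤ _ := integral_mono ((integrable_finsetSum _ fun j _ => hind j).const_mul _)
        ((memLp_two_widthAlong_sparse n hs).integrable one_le_two) hpt

/-! ### Integer rounding and choice of constants. -/

/-- With `m = ⌊s⌋` and `k = ⌊n/m⌋`, rounding costs two factors of 2: `s ≤ 2m`, and `2n/s ≤ 2(k + 1)
≤ (2k)²` inside the logarithm. -/
theorem mul_log_two_mul_div_le {n : ℕ} {s : ℝ} (hs : 1 ≤ s) (hsn : s ≤ n) :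
    s * Real.log (2 * n / s) ≤ 4 * (⌊s⌋₊ * Real.log (2 * (n / ⌊s⌋₊ : ℕ))) := by
  have hs0 : 0 < s := by linarith
  have hm : 1 ≤ ⌊s⌋₊ := Nat.le_floor (by simpa using hs)
  have hmn : ⌊s⌋₊ ≤ n := Nat.floor_le_of_le hsn
  have hm1 : (1 : ℝ) ≤ ⌊s⌋₊ := by exact_mod_cast hm
  have hk : 1 ≤ n / ⌊s⌋₊ := (Nat.one_le_div_iff hm).2 hmn
  have hk1 : (1 : ℝ) ≤ (n / ⌊s⌋₊ : ℕ) := by exact_mod_cast hk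
  have hnk : (n : ℝ) ≤ ⌊s⌋₊ * ((n / ⌊s⌋₊ : ℕ) + 1) := by
    exact_mod_cast (Nat.lt_mul_div_succ n hm).le
  have hsm : s ≤ 2 * ⌊s⌋₊ := by linarith [Nat.lt_floor_add_one s]
  have hms := Nat.floor_le hs0.le
  have hn : (0 : ℝ) < n := by linarith
  have hlog : Real.log (2 * n / s) ≤ 2 * Real.log (2 * (n / ⌊s⌋₊ : ℕ)) := by
    rw [← Real.log_rpow (by linarith), Real.rpow_two]
    refine Real.log_le_log (by positivity) ?_
    rw [div_le_iff₀ (by linarith)]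
    nlinarith [mul_nonneg (sub_nonneg.2 hms) (sq_nonneg ((n / ⌊s⌋₊ : ℕ) : ℝ)),
      mul_nonneg (mul_nonneg (sub_nonneg.2 hk1) (sub_nonneg.2 hk1)) (by linarith : (0:ℝ) ≤ ⌊s⌋₊),
      mul_nonneg (sub_nonneg.2 hk1) (by linarith : (0:ℝ) ≤ ⌊s⌋₊)]
  have hl0 : 0 ≤ Real.log (2 * (n / ⌊s⌋₊ : ℕ)) := Real.log_nonneg (by linarith)
  calc _ ≤ s * (2 * Real.log (2 * (n / ⌊s⌋₊ : ℕ))) := by gcongr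
    _ ≤ 2 * ⌊s⌋₊ * (2 * Real.log (2 * (n / ⌊s⌋₊ : ℕ))) := by gcongr
    _ = _ := by ring

theorem mainTheorem7 :
    ∃ c C : ℝ, 0 < c ∧ 0 < C ∧
      ∀ (n : ℕ) (s : ℝ), 0 < s → s ≤ (n : ℝ) →
        Integrable (widthAlong (sparseSignalSet n s))
            (stdGaussian (EuclideanSpace ℝ (Fin n))) ∧
        (1 ≤ s →
          c * (s * Real.log (2 * n / s)) ≤ gaussianMeanWidth (sparseSignalSet n s) ^ 2) ∧
        gaussianMeanWidth (sparseSignalSet n s) ^ 2 ≤ C * (s * Real.log (2 * n / s)) := by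
  set q := 1 - Real.exp (-((√(2 * Real.pi))⁻¹ * Real.exp (-1) / 2)) with hq
  have hq0 : 0 < q := by
    rw [hq, sub_pos, Real.exp_lt_one_iff, neg_lt_zero]
    positivity
  have hlog2 : 0 < Real.log 2 := Real.log_pos one_lt_two
  -- In `c`, the rounding loss 4 cancels the square of the factor 2 in the width. In `C`, the second
  -- term absorbs a remainder `8√2 s` through `log 2 ≤ log (2n/s)`.
  refine ⟨q ^ 2, 16 + 8 * √2 / Real.log 2, by positivity, by positivity, fun n s hs hsn => ?_⟩
  have hn : (0 : ℝ) < n := hs.trans_le hsn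
  have hratio : 2 ≤ 2 * n / s := by rw [le_div_iff₀ hs]; linarith
  have hlog : Real.log 2 ≤ Real.log (2 * n / s) := Real.log_le_log two_pos hratio
  refine ⟨(memLp_two_widthAlong_sparse n hs.le).integrable one_le_two, fun hs1 => ?_, ?_⟩
  · have hm : 0 < ⌊s⌋₊ := Nat.floor_pos.2 hs1
    have hk : 0 < n / ⌊s⌋₊ := Nat.div_pos (Nat.floor_le_of_le hsn) hm
    have hk1 : (1 : ℝ) ≤ (n / ⌊s⌋₊ : ℕ) := by exact_mod_cast hk
    have h := le_gaussianMeanWidth_sparse hm hk (Nat.floor_le hs.le) (Nat.mul_div_le n ⌊s⌋₊)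
    rw [← hq] at h
    refine le_trans ?_ (pow_le_pow_left₀ (by positivity) h 2)
    rw [mul_pow, mul_pow, mul_pow, Real.sq_sqrt (Nat.cast_nonneg _),
      Real.sq_sqrt (Real.log_nonneg (by linarith))]
    calc _ ≤ q ^ 2 * (4 * (⌊s⌋₊ * Real.log (2 * (n / ⌊s⌋₊ : ℕ)))) :=
          mul_le_mul_of_nonneg_left (mul_log_two_mul_div_le hs1 hsn) (sq_nonneg q)
      _ = _ := by ring
  -- This `t` gives `exp (-t/4) = s / (2n)`, which cancels the `n` from summing over all
  -- coordinates.
  · refine (gaussianMeanWidth_sparse_sq_le hs.le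
      (t := 4 * Real.log (2 * n / s)) (by linarith)).trans ?_
    have he : Real.exp (-(4 * Real.log (2 * n / s)) / 4) = s / (2 * n) := by
      rw [show -(4 * Real.log (2 * n / s)) / 4 = -Real.log (2 * n / s) by ring, Real.exp_neg,
        Real.exp_log (by positivity), inv_div]
    rw [he]
    have h1 : 4 * (s * (4 * Real.log (2 * n / s)) + 4 * (s / (2 * n)) * (n * √2)) =
        16 * (s * Real.log (2 * n / s)) + 8 * √2 / Real.log 2 * (s * Real.log 2) := by
      field_simp
      ring
    rw [h1, add_mul]
    gcongr
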